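/- For a finite metric space $(X,d)$ let $\mathrm{TC}(X)$ be the transportation cost space of $X$: the real vector space of all functions $f\colon X\to\mathbb{R}$ with $\sum_{v\in X}f(v)=0$, equipped with the norm $$\|f\|_{\mathrm{TC}}=\inf\Big\{\sum_{i=1}^m a_i\,d(x_i,y_i)\;:\; f=\sum_{i=1}^m a_i(\mathbf 1_{x_i}-\mathbf 1_{y_i}),\ m\ge 0,\ a_i\ge 0,\ x_i,y_i\in X\Big\}.$$ For normed spaces $Y_1,Y_2$ of the same finite dimension let $$d_{BM}(Y_1,Y_2)=\inf\{\|T\|\cdot\|T^{-1}\| : T\colon Y_1\to Y_2 \text{ is a linear isomorphism}\}$$ be the Banach–Mazur distance. Let $\mathbb{Z}_2^n$ be the Hamming cube, with the Hamming metric $d(x,y)=\#\{i: x_i\ne y_i\}$. Then for every integer $n\ge 1$, $$\frac{n+1}{2}\;\le\; d_{BM}\big(\mathrm{TC}(\mathbb{Z}_2^n),\,\ell_1^{2^n-1}\big)\;\le\; 2n.$$ -/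

import Mathlib

noncomputable section

/-- The real vector space `TP(X)` of transportation problems on a finite set `X`: real-valued
functions on `X` with zero sum. -/
def TransportationProblem (X : Type*) [Fintype X] : Submodule ℝ (X → ℝ) where
  carrier := {f | ∑ v, f v = 0}
  add_mem' := by
    intro f g hf hg
    simp only [Set.mem_ofPred_eq, Pi.add_apply, Finset.sum_add_distrib] at *
    rw [hf, hg, add_zero]
  zero_mem' := by simp
  smul_mem' := by
    intro c f hf
    simp only [Set.mem_ofPred_eq, Pi.smul_apply, smul_eq_mul, ← Finset.mul_sum] at *
    rw [hf, mul_zero]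

/-- `IsTransportationPlan f a x y` says that
`f = a₁ (1_{x₁} - 1_{y₁}) + ⋯ + aₘ (1_{xₘ} - 1_{yₘ})` with all `aᵢ ≥ 0`. -/
def IsTransportationPlan {X : Type*} (f : X → ℝ) {m : ℕ} (a : Fin m → ℝ) (x y : Fin m → X) :
    Prop :=
  (∀ i, 0 ≤ a i) ∧
    f = ∑ i, a i • (Set.indicator {x i} (fun _ => (1 : ℝ)) - Set.indicator {y i} (fun _ => 1))

/-- The set of the costs `∑ aᵢ d(xᵢ, yᵢ)` of all transportation plans for `f`. -/
def transportationCosts {X : Type*} [MetricSpace X] (f : X → ℝ) : Set ℝ :=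
  {c | ∃ (m : ℕ) (a : Fin m → ℝ) (x y : Fin m → X),
    IsTransportationPlan f a x y ∧ c = ∑ i, a i * dist (x i) (y i)}

/-- The transportation cost of `f`: the infimum of the costs of transportation plans for `f`. -/
def transportationCost {X : Type*} [MetricSpace X] (f : X → ℝ) : ℝ :=
  sInf (transportationCosts f)

section costs

variable {X : Type*} [MetricSpace X]

theorem transportationCosts_nonneg {f : X → ℝ} {c : ℝ} (hc : c ∈ transportationCosts f) :
    0 ≤ c := by
  obtain ⟨m, a, x, y, ⟨ha, -⟩, rfl⟩ := hc
  exact Finset.sum_nonneg fun i _ => mul_nonneg (ha i) dist_nonneg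

theorem transportationCosts_bddBelow (f : X → ℝ) : BddBelow (transportationCosts f) :=
  ⟨0, fun _ hc => transportationCosts_nonneg hc⟩

theorem transportationCost_nonneg (f : X → ℝ) : 0 ≤ transportationCost f :=
  Real.sInf_nonneg fun _ hc => transportationCosts_nonneg hc

theorem transportationCosts_zero : (0 : ℝ) ∈ transportationCosts (0 : X → ℝ) :=
  ⟨0, Fin.elim0, Fin.elim0, Fin.elim0, ⟨fun i => i.elim0, by simp⟩, by simp⟩

theorem transportationCosts_add {f g : X → ℝ} {c d : ℝ} (hc : c ∈ transportationCosts f)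
    (hd : d ∈ transportationCosts g) : c + d ∈ transportationCosts (f + g) := by
  obtain ⟨m, a, x, y, ⟨ha, rfl⟩, rfl⟩ := hc
  obtain ⟨k, b, u, v, ⟨hb, rfl⟩, rfl⟩ := hd
  refine ⟨m + k, Fin.append a b, Fin.append x u, Fin.append y v, ⟨?_, ?_⟩, ?_⟩
  · intro i
    refine Fin.addCases (fun j => ?_) (fun j => ?_) i
    · simpa using ha j
    · simpa using hb j
  · simp [Fin.sum_univ_add]
  · simp [Fin.sum_univ_add]

theorem transportationCosts_smul {f : X → ℝ} {c : ℝ} (r : ℝ) (hc : c ∈ transportationCosts f) :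
    |r| * c ∈ transportationCosts (r • f) := by
  obtain ⟨m, a, x, y, ⟨ha, rfl⟩, rfl⟩ := hc
  rcases le_total 0 r with hr | hr
  · refine ⟨m, fun i => r * a i, x, y, ⟨fun i => mul_nonneg hr (ha i), ?_⟩, ?_⟩
    · simp only [Finset.smul_sum, smul_smul]
    · simp only [abs_of_nonneg hr, Finset.mul_sum, mul_assoc]
  · refine ⟨m, fun i => -r * a i, y, x,
      ⟨fun i => mul_nonneg (neg_nonneg.2 hr) (ha i), ?_⟩, ?_⟩
    · simp only [Finset.smul_sum, smul_smul]
      refine Finset.sum_congr rfl fun i _ => ?_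
      rw [← neg_sub, smul_neg, ← neg_smul, neg_mul]
    · simp only [abs_of_nonpos hr, Finset.mul_sum, mul_assoc, dist_comm]

theorem transportationCosts_sum {ι : Type*} (s : Finset ι) (f : ι → X → ℝ) (c : ι → ℝ)
    (h : ∀ i ∈ s, c i ∈ transportationCosts (f i)) :
    ∑ i ∈ s, c i ∈ transportationCosts (∑ i ∈ s, f i) := by
  classical
  induction s using Finset.induction_on with
  | empty => simpa using transportationCosts_zero
  | insert i s hi ih =>
    rw [Finset.sum_insert hi, Finset.sum_insert hi]
    exact transportationCosts_add (h i (by simp)) (ih fun j hj => h j (by simp [hj]))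

theorem transportationCosts_nonempty [Fintype X] {f : X → ℝ}
    (hf : f ∈ TransportationProblem X) : (transportationCosts f).Nonempty := by
  classical
  have hf0 : ∑ v, f v = 0 := hf
  rcases isEmpty_or_nonempty X with hX | ⟨⟨o⟩⟩
  · have : f = 0 := Subsingleton.elim _ _
    exact ⟨0, this ▸ transportationCosts_zero⟩
  · have key : f = ∑ v, f v • (Set.indicator {v} (fun _ => (1 : ℝ)) -
        Set.indicator {o} (fun _ => 1)) := by
      funext z
      simp only [Finset.sum_apply, Pi.smul_apply, Pi.sub_apply, smul_eq_mul, mul_sub,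
        Finset.sum_sub_distrib, ← Finset.sum_mul, hf0, Set.indicator_apply,
        Set.mem_singleton_iff]
      simp
    rw [key]
    refine ⟨_, transportationCosts_sum Finset.univ _ (fun v => |f v| * dist v o) fun v _ => ?_⟩
    refine transportationCosts_smul (f v) ⟨1, fun _ => 1, fun _ => v, fun _ => o, ⟨?_, ?_⟩, ?_⟩
    · simp
    · simp
    · simp

theorem transportationCost_add_le [Fintype X] {f g : X → ℝ} (hf : f ∈ TransportationProblem X)
    (hg : g ∈ TransportationProblem X) :
    transportationCost (f + g) ≤ transportationCost f + transportationCost g := by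
  refine le_of_forall_pos_le_add fun ε hε => ?_
  obtain ⟨c, hc, hc'⟩ := exists_lt_of_csInf_lt (transportationCosts_nonempty hf)
    (show sInf (transportationCosts f) < transportationCost f + ε / 2 from by
      rw [transportationCost]; linarith)
  obtain ⟨d, hd, hd'⟩ := exists_lt_of_csInf_lt (transportationCosts_nonempty hg)
    (show sInf (transportationCosts g) < transportationCost g + ε / 2 from by
      rw [transportationCost]; linarith)
  have := csInf_le (transportationCosts_bddBelow (f + g)) (transportationCosts_add hc hd)
  rw [← transportationCost] at this
  linarith

theorem transportationCost_zero : transportationCost (0 : X → ℝ) = 0 :=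
  le_antisymm (csInf_le (transportationCosts_bddBelow _) transportationCosts_zero)
    (transportationCost_nonneg _)

theorem transportationCost_smul_le [Fintype X] {f : X → ℝ} (hf : f ∈ TransportationProblem X)
    (r : ℝ) : transportationCost (r • f) ≤ |r| * transportationCost f := by
  rcases eq_or_ne r 0 with rfl | hr
  · simp [transportationCost_zero]
  · have hr' : 0 < |r| := abs_pos.2 hr
    rw [← div_le_iff₀' hr']
    refine le_csInf (transportationCosts_nonempty hf) fun c hc => ?_
    rw [div_le_iff₀' hr']
    exact csInf_le (transportationCosts_bddBelow _) (transportationCosts_smul r hc)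

theorem transportationCost_smul [Fintype X] {f : X → ℝ} (hf : f ∈ TransportationProblem X)
    (r : ℝ) : transportationCost (r • f) = |r| * transportationCost f := by
  refine le_antisymm (transportationCost_smul_le hf r) ?_
  rcases eq_or_ne r 0 with rfl | hr
  · simp [transportationCost_zero]
  · have h := transportationCost_smul_le (Submodule.smul_mem _ r hf) r⁻¹
    rw [smul_smul, inv_mul_cancel₀ hr, one_smul, abs_inv] at h
    calc |r| * transportationCost f ≤ |r| * (|r|⁻¹ * transportationCost (r • f)) :=
          mul_le_mul_of_nonneg_left h (abs_nonneg r)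
      _ = transportationCost (r • f) := by
          rw [← mul_assoc, mul_inv_cancel₀ (abs_ne_zero.2 hr), one_mul]

theorem abs_mul_le_of_mem_transportationCosts {δ : ℝ} (hδ : 0 < δ)
    (h : ∀ x y : X, x ≠ y → δ ≤ dist x y) {f : X → ℝ} {c : ℝ}
    (hc : c ∈ transportationCosts f) (z : X) : δ * |f z| ≤ c := by
  classical
  obtain ⟨m, a, x, y, ⟨ha, rfl⟩, rfl⟩ := hc
  rw [Finset.sum_apply]
  calc δ * |∑ i, (a i • (Set.indicator {x i} (fun _ => (1 : ℝ)) -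
          Set.indicator {y i} (fun _ => 1)) : X → ℝ) z|
      ≤ δ * ∑ i, |(a i • (Set.indicator {x i} (fun _ => (1 : ℝ)) -
          Set.indicator {y i} (fun _ => 1)) : X → ℝ) z| :=
        mul_le_mul_of_nonneg_left (Finset.abs_sum_le_sum_abs _ _) hδ.le
    _ ≤ ∑ i, a i * dist (x i) (y i) := by
        rw [Finset.mul_sum]
        refine Finset.sum_le_sum fun i _ => ?_
        simp only [Pi.smul_apply, Pi.sub_apply, smul_eq_mul, abs_mul, abs_of_nonneg (ha i)]
        rw [mul_left_comm]
        refine mul_le_mul_of_nonneg_left ?_ (ha i)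
        by_cases hxy : x i = y i
        · simp [hxy]
        · have hle : |Set.indicator {x i} (fun _ => (1 : ℝ)) z -
              Set.indicator {y i} (fun _ => 1) z| ≤ 1 := by
            simp only [Set.indicator_apply]
            split_ifs <;> norm_num
          calc δ * _ ≤ δ * 1 := mul_le_mul_of_nonneg_left hle hδ.le
            _ = δ := mul_one δ
            _ ≤ _ := h _ _ hxy

theorem exists_pos_le_dist (X : Type*) [MetricSpace X] [Finite X] :
    ∃ δ : ℝ, 0 < δ ∧ ∀ x y : X, x ≠ y → δ ≤ dist x y := by
  classical
  cases nonempty_fintype X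
  let s : Finset ℝ := insert 1 ((Finset.univ.filter fun p : X × X => p.1 ≠ p.2).image
    fun p => dist p.1 p.2)
  have hs : s.Nonempty := ⟨1, by simp [s]⟩
  refine ⟨s.min' hs, ?_, fun x y hxy => Finset.min'_le _ _ ?_⟩
  · rw [Finset.lt_min'_iff]
    intro r hr
    simp only [s, Finset.mem_insert, Finset.mem_image, Finset.mem_filter, Finset.mem_univ,
      true_and] at hr
    rcases hr with rfl | ⟨p, hp, rfl⟩
    · exact one_pos
    · exact dist_pos.2 hp
  · simp only [s, Finset.mem_insert, Finset.mem_image, Finset.mem_filter, Finset.mem_univ,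
      true_and]
    exact Or.inr ⟨(x, y), hxy, rfl⟩

theorem transportationCost_eq_zero [Fintype X] {f : X → ℝ} (hf : f ∈ TransportationProblem X) :
    transportationCost f = 0 ↔ f = 0 := by
  refine ⟨fun h0 => ?_, fun h0 => h0 ▸ transportationCost_zero⟩
  obtain ⟨δ, hδ, h⟩ := exists_pos_le_dist X
  funext z
  have h1 : δ * |f z| ≤ transportationCost f :=
    le_csInf (transportationCosts_nonempty hf) fun c hc =>
      abs_mul_le_of_mem_transportationCosts hδ h hc z
  rw [h0] at h1
  have h2 : |f z| ≤ 0 := by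
    by_contra hcon
    exact absurd h1 (not_le.2 (mul_pos hδ (not_le.1 hcon)))
  simpa using h2

end costs

/-- The transportation cost space `TC(X)` of a finite metric space `X`: the space of
transportation problems on `X` with the transportation cost norm. A type synonym, so that it does
not inherit the sup norm. -/
def TCSpace (X : Type*) [Fintype X] : Type _ := ↥(TransportationProblem X)

namespace TCSpace

variable {X : Type*} [Fintype X]

instance : AddCommGroup (TCSpace X) := inferInstanceAs (AddCommGroup ↥(TransportationProblem X))

instance : Module ℝ (TCSpace X) := inferInstanceAs (Module ℝ ↥(TransportationProblem X))

/-- A transportation problem as an element of the transportation cost space. -/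
def equiv (X : Type*) [Fintype X] : TCSpace X ≃ₗ[ℝ] ↥(TransportationProblem X) :=
  LinearEquiv.refl ℝ ↥(TransportationProblem X)

variable [MetricSpace X]

instance : Norm (TCSpace X) where
  norm f := transportationCost (equiv X f : X → ℝ)

theorem norm_def (f : TCSpace X) : ‖f‖ = transportationCost (equiv X f : X → ℝ) := rfl

theorem core : NormedSpace.Core ℝ (TCSpace X) where
  norm_nonneg f := transportationCost_nonneg _
  norm_smul r f := by
    simp only [norm_def, map_smul, Submodule.coe_smul, Real.norm_eq_abs]
    exact transportationCost_smul (equiv X f).2 r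
  norm_triangle f g := by
    simp only [norm_def, map_add, Submodule.coe_add]
    exact transportationCost_add_le (equiv X f).2 (equiv X g).2
  norm_eq_zero_iff f := by
    rw [norm_def, transportationCost_eq_zero (equiv X f).2]
    simp

instance : NormedAddCommGroup (TCSpace X) := NormedAddCommGroup.ofCore core

instance : NormedSpace ℝ (TCSpace X) := NormedSpace.ofCore core

end TCSpace

/-- The Banach-Mazur distance between normed spaces of the same finite dimension:
the infimum of `‖T‖ * ‖T⁻¹‖` over all linear isomorphisms `T` (automatically continuous). -/
def banachMazurDist (Y₁ Y₂ : Type*) [NormedAddCommGroup Y₁] [NormedSpace ℝ Y₁]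
    [NormedAddCommGroup Y₂] [NormedSpace ℝ Y₂] : ℝ :=
  sInf {r | ∃ T : Y₁ ≃L[ℝ] Y₂,
    r = ‖(T : Y₁ →L[ℝ] Y₂)‖ * ‖(T.symm : Y₂ →L[ℝ] Y₁)‖}

/-- The Hamming cube `ℤ₂ⁿ` with the Hamming metric. -/
abbrev HammingCube (n : ℕ) : Type := Hamming fun _ : Fin n => ZMod 2

/-- The space `ℓ₁ᴺ`. -/
abbrev EllOne (N : ℕ) : Type := PiLp 1 fun _ : Fin N => ℝ

end

/-!
The upper bound comes from the star basis `1_v - 1_o`, `v ≠ o`, of the transportation cost space: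
the coordinates of `f` in it have `ℓ₁` norm at most `2 ‖f‖` because distinct points are at distance
at least `1`, and each basis vector has norm at most `n`.

For the lower bound let `T` be an isomorphism onto `ℓ₁ᴺ` and let `W_S` be the Walsh functions. Take
`𝒮` to be the family of all sets `S` of one or two coordinates, and for each coordinate `j` of
`ℓ₁ᴺ` put `g_j = ∑_{S ∈ 𝒮} T(W_S)_j W_S`. Two facts are played off against each other.

* The trace `∑_j ⟨T⁻¹ e_j, g_j⟩` does not depend on `T`: it equals
  `∑_{S ∈ 𝒮} ⟨W_S, W_S⟩ = 2ⁿ n (n + 1) / 2` (`sum_pairing_symm_single`).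
* Across an edge in direction `l`, only the `n` sets `S = {l, k}` contribute to the increment of
  `g_j`, and `2 W_{l,k}` is a `±1`-combination of the differences `1_y - 1_{y + e_k}`. Hence `g_j` is
  Lipschitz with constant `τ_j = ∑_{edges} |T(1_y - 1_{y + e_k})_j|`
  (`abs_walshSum_sub_flip_le`), where every edge is counted with both orientations.

The easy half of Kantorovich duality (`abs_pairing_le`) then bounds the trace by
`∑_j τ_j ‖T⁻¹‖ ≤ n 2ⁿ ‖T‖ ‖T⁻¹‖`. The family `𝒮` is found by inspecting the orthogonal projection
of the edge space onto the cut space: for `k ≠ l` the current through edges in direction `k` due to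
a unit source and sink at the ends of an edge in direction `l` has the sign pattern `W_{l,k}`, and
for `k = l` the pattern `W_{l}`.
-/

/-! ### Transportation cost spaces: dipoles and the pairing with functions -/

namespace TCSpace

variable {X : Type*} [Fintype X]

/-- The function underlying an element of the transportation cost space, as a linear map. -/
def toFun (X : Type*) [Fintype X] : TCSpace X →ₗ[ℝ] X → ℝ :=
  (TransportationProblem X).subtype ∘ₗ (equiv X).toLinearMap

theorem toFun_injective : Function.Injective (toFun X) :=
  fun _ _ h => (equiv X).injective (Subtype.ext h)

theorem sum_toFun (f : TCSpace X) : ∑ v, toFun X f v = 0 := (equiv X f).2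

/-- A function of zero sum as an element of the transportation cost space. -/
def ofFun (f : X → ℝ) (hf : ∑ v, f v = 0) : TCSpace X := (equiv X).symm ⟨f, hf⟩

@[simp]
theorem toFun_ofFun (f : X → ℝ) (hf : ∑ v, f v = 0) : toFun X (ofFun f hf) = f := rfl

/-- The transportation problem `1_x - 1_y`. -/
noncomputable def dipole (x y : X) : TCSpace X :=
  ofFun (Set.indicator {x} (fun _ => (1 : ℝ)) - Set.indicator {y} (fun _ => 1)) (by
    classical simp)

theorem toFun_dipole [DecidableEq X] (x y z : X) :
    toFun X (dipole x y) z = (if z = x then 1 else 0) - if z = y then 1 else 0 := by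
  simp [dipole, Pi.single_apply]

/-- The pairing `f ↦ ∑ v, f v * g v` with a function `g`. -/
def pairing (g : X → ℝ) : TCSpace X →ₗ[ℝ] ℝ :=
  ∑ v, g v • (LinearMap.proj v ∘ₗ toFun X)

theorem pairing_apply (g : X → ℝ) (f : TCSpace X) : pairing g f = ∑ v, g v * toFun X f v := by
  simp [pairing]

variable [MetricSpace X]

theorem norm_dipole_le (x y : X) : ‖dipole x y‖ ≤ dist x y :=
  csInf_le (transportationCosts_bddBelow _)
    ⟨1, fun _ => 1, fun _ => x, fun _ => y,
      ⟨fun _ => zero_le_one, by change toFun X (dipole x y) = _; simp [dipole]⟩, by simp⟩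

/-- The easy half of Kantorovich duality: a `τ`-Lipschitz function has norm at most `τ` as a
functional on the transportation cost space. -/
theorem abs_pairing_le {g : X → ℝ} {τ : ℝ} (hτ : 0 ≤ τ)
    (hg : ∀ x y, |g x - g y| ≤ τ * dist x y)
    (f : TCSpace X) : |pairing g f| ≤ τ * ‖f‖ := by
  have key : ∀ c ∈ transportationCosts (toFun X f), |pairing g f| ≤ τ * c := by
    rintro c ⟨m, a, x, y, ⟨ha, hf⟩, rfl⟩
    have h1 : f = ∑ i, a i • dipole (x i) (y i) := by
      apply toFun_injective
      rw [hf, map_sum]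
      simp [dipole]
    have h2 : ∀ x y, pairing g (dipole x y) = g x - g y := by
      classical
      intro x y
      simp [pairing_apply, toFun_dipole, mul_sub]
    rw [h1, map_sum, Finset.mul_sum]
    refine (Finset.abs_sum_le_sum_abs _ _).trans (Finset.sum_le_sum fun i _ => ?_)
    rw [map_smul, h2, smul_eq_mul, abs_mul, abs_of_nonneg (ha i), mul_left_comm]
    exact mul_le_mul_of_nonneg_left (hg _ _) (ha i)
  have hne : (transportationCosts (toFun X f)).Nonempty :=
    transportationCosts_nonempty (equiv X f).2
  rcases hτ.eq_or_lt with rfl | hτ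
  · obtain ⟨c, hc⟩ := hne
    simpa using key c hc
  · rw [← div_le_iff₀' hτ]
    exact le_csInf hne fun c hc => (div_le_iff₀' hτ).2 (key c hc)

end TCSpace

/-! ### The star basis and the upper bound -/

theorem banachMazurDist_le {Y₁ Y₂ : Type*} [NormedAddCommGroup Y₁] [NormedSpace ℝ Y₁]
    [NormedAddCommGroup Y₂] [NormedSpace ℝ Y₂] (T : Y₁ ≃L[ℝ] Y₂) :
    banachMazurDist Y₁ Y₂ ≤ ‖(T : Y₁ →L[ℝ] Y₂)‖ * ‖(T.symm : Y₂ →L[ℝ] Y₁)‖ := by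
  refine csInf_le ⟨0, ?_⟩ ⟨T, rfl⟩
  rintro r ⟨S, rfl⟩
  positivity

namespace TCSpace

variable {X : Type*} [Fintype X]

/-- The sum is split at `o` into `f o` and the values at the enumerated points `e j ≠ o`. -/
theorem sum_eq_add_sum_star {N : ℕ} {o : X} (e : Fin N ≃ {v : X // v ≠ o}) (h : X → ℝ) :
    ∑ v, h v = h o + ∑ j, h (e j) := by
  classical
  rw [Fintype.sum_eq_add_sum_subtype_ne h o, ← e.sum_comp]

/-- The coordinates in the basis of the dipoles `1_v - 1_o`, `v ≠ o`: the values of `f` at the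
points different from `o`, which `e` enumerates. -/
noncomputable def starMap {N : ℕ} {o : X} (e : Fin N ≃ {v : X // v ≠ o}) :
    TCSpace X →ₗ[ℝ] EllOne N :=
  (WithLp.linearEquiv 1 ℝ (Fin N → ℝ)).symm.toLinearMap ∘ₗ
    LinearMap.funLeft ℝ ℝ (fun j => (e j : X)) ∘ₗ toFun X

@[simp]
theorem starMap_apply {N : ℕ} {o : X} (e : Fin N ≃ {v : X // v ≠ o}) (f : TCSpace X) (j : Fin N) :
    starMap e f j = toFun X f (e j) := rfl

theorem starMap_injective {N : ℕ} {o : X} (e : Fin N ≃ {v : X // v ≠ o}) :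
    Function.Injective (starMap e) := by
  refine (injective_iff_map_eq_zero _).2 fun f hf => toFun_injective ?_
  have h0 : ∀ j, toFun X f (e j) = 0 := fun j => by rw [← starMap_apply e f j, hf]; rfl
  have ho : toFun X f o = 0 := by
    have := sum_toFun f
    rw [sum_eq_add_sum_star e] at this
    simpa [h0] using this
  funext v
  rw [map_zero, Pi.zero_apply]
  by_cases hv : v = o
  · rw [hv, ho]
  · simpa using h0 (e.symm ⟨v, hv⟩)

theorem starMap_sum_dipole {N : ℕ} {o : X} (e : Fin N ≃ {v : X // v ≠ o}) (g : EllOne N) :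
    starMap e (∑ j, g j • dipole (e j : X) o) = g := by
  classical
  ext k
  have h : ∀ j, ((e k : X) = e j) = (k = j) := fun j => by
    rw [Subtype.coe_inj, e.injective.eq_iff]
  simp [toFun_dipole, h, (e k).2]

/-- `starMap` as a linear isomorphism. -/
noncomputable def starEquiv {N : ℕ} {o : X} (e : Fin N ≃ {v : X // v ≠ o}) :
    TCSpace X ≃ₗ[ℝ] EllOne N :=
  LinearEquiv.ofBijective (starMap e)
    ⟨starMap_injective e, fun g => ⟨_, starMap_sum_dipole e g⟩⟩

theorem starEquiv_symm_apply {N : ℕ} {o : X} (e : Fin N ≃ {v : X // v ≠ o}) (g : EllOne N) :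
    (starEquiv e).symm g = ∑ j, g j • dipole (e j : X) o :=
  (LinearEquiv.symm_apply_eq _).2 (starMap_sum_dipole e g).symm

variable [MetricSpace X]

theorem norm_starEquiv_le (h1 : ∀ x y : X, x ≠ y → 1 ≤ dist x y) {N : ℕ} {o : X}
    (e : Fin N ≃ {v : X // v ≠ o}) (f : TCSpace X) : ‖starEquiv e f‖ ≤ 2 * ‖f‖ := by
  -- The sign function of `f` is `2`-Lipschitz, and pairing it with `f` gives `∑ v, |f v|`.
  have h2 : ∀ x y : X, |((SignType.sign (toFun X f x) : SignType) : ℝ) -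
      ((SignType.sign (toFun X f y) : SignType) : ℝ)| ≤ 2 * dist x y := by
    intro x y
    rcases eq_or_ne x y with rfl | hxy
    · simp
    · have hs : ∀ s : SignType, |(s : ℝ)| ≤ 1 := fun s => by cases s <;> simp
      have h3 := (abs_sub _ _).trans (add_le_add (hs (SignType.sign (toFun X f x)))
        (hs (SignType.sign (toFun X f y))))
      linarith [h1 x y hxy]
  have h4 := (le_abs_self _).trans (abs_pairing_le zero_le_two h2 f)
  simp only [pairing_apply, sign_mul_self] at h4
  rw [sum_eq_add_sum_star e] at h4
  rw [PiLp.norm_eq_of_L1]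
  exact (le_add_of_nonneg_left (abs_nonneg _)).trans h4

theorem norm_starEquiv_symm_le {D : ℝ} (hD : ∀ x y : X, dist x y ≤ D) {N : ℕ} {o : X}
    (e : Fin N ≃ {v : X // v ≠ o}) (g : EllOne N) : ‖(starEquiv e).symm g‖ ≤ D * ‖g‖ := by
  rw [starEquiv_symm_apply, PiLp.norm_eq_of_L1, Finset.mul_sum]
  refine (norm_sum_le _ _).trans (Finset.sum_le_sum fun j _ => ?_)
  rw [norm_smul, mul_comm]
  exact mul_le_mul_of_nonneg_right ((norm_dipole_le _ _).trans (hD _ _)) (norm_nonneg _)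

/-- If all distances between distinct points lie in `[1, D]`, then the transportation cost space
is `2 D`-isomorphic to `ℓ₁`. -/
theorem exists_equiv_ellOne [Nonempty X] {D : ℝ} (h1 : ∀ x y : X, x ≠ y → 1 ≤ dist x y)
    (hD : ∀ x y : X, dist x y ≤ D) :
    ∃ T : TCSpace X ≃L[ℝ] EllOne (Fintype.card X - 1),
      ‖(T : TCSpace X →L[ℝ] EllOne (Fintype.card X - 1))‖ *
        ‖(T.symm : EllOne (Fintype.card X - 1) →L[ℝ] TCSpace X)‖ ≤ 2 * D := by
  classical
  obtain ⟨o⟩ := ‹Nonempty X›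
  have hD0 : 0 ≤ D := dist_nonneg.trans (hD o o)
  have hc : Fintype.card {v : X // v ≠ o} = Fintype.card X - 1 := by
    rw [Fintype.card_subtype_compl, Fintype.card_subtype_eq]
  let e := (Fintype.equivFinOfCardEq hc).symm
  refine ⟨(starEquiv e).toContinuousLinearEquivOfBounds 2 D (norm_starEquiv_le h1 e)
    (norm_starEquiv_symm_le hD e), ?_⟩
  exact mul_le_mul
    (ContinuousLinearMap.opNorm_le_bound _ zero_le_two (norm_starEquiv_le h1 e))
    (ContinuousLinearMap.opNorm_le_bound _ hD0 (norm_starEquiv_symm_le hD e))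
    (norm_nonneg _) zero_le_two

end TCSpace

/-! ### The Hamming cube and its Walsh functions -/

namespace HammingCube

variable {n : ℕ}

theorem card_eq : Fintype.card (HammingCube n) = 2 ^ n := by
  change Fintype.card (Fin n → ZMod 2) = _
  simp

theorem one_le_dist {x y : HammingCube n} (h : x ≠ y) : 1 ≤ dist x y := by
  rw [Hamming.dist_eq_hammingDist]
  exact_mod_cast hammingDist_pos.2 h

theorem dist_le (x y : HammingCube n) : dist x y ≤ n := by
  rw [Hamming.dist_eq_hammingDist]
  exact_mod_cast hammingDist_le_card_fintype.trans (Fintype.card_fin n).le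

/-- The neighbour of `x` in direction `k`. -/
def flip (k : Fin n) (x : HammingCube n) : HammingCube n :=
  Hamming.toHamming (Function.update (Hamming.ofHamming x) k (Hamming.ofHamming x k + 1))

theorem flip_apply (k i : Fin n) (x : HammingCube n) :
    Hamming.ofHamming (flip k x) i =
      if i = k then Hamming.ofHamming x k + 1 else Hamming.ofHamming x i := by
  simp [flip, Function.update_apply]

theorem flip_flip (k : Fin n) (x : HammingCube n) : flip k (flip k x) = x := by
  apply Hamming.ofHamming.injective
  funext i
  rw [flip_apply]
  split_ifs with h
  · rw [flip_apply, if_pos rfl, h, add_assoc, CharTwo.add_self_eq_zero, add_zero]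
  · rw [flip_apply, if_neg h]

theorem dist_flip_le (k : Fin n) (x : HammingCube n) : dist x (flip k x) ≤ 1 := by
  rw [Hamming.dist_eq_hammingDist, hammingDist]
  have : (Finset.univ.filter fun i =>
      Hamming.ofHamming x i ≠ Hamming.ofHamming (flip k x) i) ⊆ {k} := by
    intro i hi
    by_contra hik
    rw [Finset.mem_singleton] at hik
    simp [flip_apply, hik] at hi
  exact_mod_cast (Finset.card_le_card this).trans (Finset.card_singleton k).le

/-- A function on the cube is Lipschitz with the constant that bounds its increments along edges. -/
theorem abs_sub_le_mul_dist {g : HammingCube n → ℝ} {τ : ℝ}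
    (hg : ∀ k x, |g x - g (flip k x)| ≤ τ) (x y : HammingCube n) :
    |g x - g y| ≤ τ * dist x y := by
  rw [Hamming.dist_eq_hammingDist]
  generalize hd : hammingDist (Hamming.ofHamming x) (Hamming.ofHamming y) = d
  induction d generalizing x with
  | zero =>
    rw [hammingDist_eq_zero, Hamming.ofHamming_inj] at hd
    simp [hd]
  | succ d ih =>
    obtain ⟨k, hk⟩ : ∃ k, Hamming.ofHamming x k ≠ Hamming.ofHamming y k := by
      by_contra! h
      have : hammingDist (Hamming.ofHamming x) (Hamming.ofHamming y) = 0 :=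
        hammingDist_eq_zero.2 (funext h)
      omega
    have hk' : Hamming.ofHamming x k + 1 = Hamming.ofHamming y k := by
      generalize Hamming.ofHamming x k = a at hk ⊢
      generalize Hamming.ofHamming y k = b at hk ⊢
      revert a b
      decide
    have hd' : hammingDist (Hamming.ofHamming (flip k x)) (Hamming.ofHamming y) = d := by
      have : (Finset.univ.filter fun i =>
          Hamming.ofHamming (flip k x) i ≠ Hamming.ofHamming y i) =
          (Finset.univ.filter fun i =>
            Hamming.ofHamming x i ≠ Hamming.ofHamming y i).erase k := by
        ext i
        by_cases hik : i = k
        · simp [hik, flip_apply, hk']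
        · simp [hik, flip_apply]
      rw [hammingDist, this, Finset.card_erase_of_mem (by simpa using hk)]
      rw [hammingDist] at hd
      omega
    have h1 := ih (flip k x) hd'
    have h2 := abs_sub_le (g x) (g (flip k x)) (g y)
    push_cast
    linarith [hg k x]

/-- The Walsh function `W_S`, the character `x ↦ (-1) ^ ∑_{i ∈ S} x_i` of the cube. -/
noncomputable def walsh (S : Finset (Fin n)) (x : HammingCube n) : ℝ :=
  ∏ i ∈ S, if Hamming.ofHamming x i = 0 then 1 else -1

theorem abs_walsh (S : Finset (Fin n)) (x : HammingCube n) : |walsh S x| = 1 := by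
  rw [walsh, Finset.abs_prod]
  exact Finset.prod_eq_one fun i _ => by split_ifs <;> simp

theorem walsh_mul_self (S : Finset (Fin n)) (x : HammingCube n) : walsh S x * walsh S x = 1 := by
  rw [← abs_mul_abs_self, abs_walsh, one_mul]

theorem walsh_flip_of_mem {S : Finset (Fin n)} {k : Fin n} (hk : k ∈ S) (x : HammingCube n) :
    walsh S (flip k x) = -walsh S x := by
  rw [walsh, walsh, ← Finset.mul_prod_erase S _ hk, ← Finset.mul_prod_erase S _ hk, ← neg_mul]
  congr 1
  · rw [flip_apply, if_pos rfl]
    generalize Hamming.ofHamming x k = a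
    have : a = 0 ∨ a = 1 := by revert a; decide
    rcases this with rfl | rfl
    · simp
    · simp [CharTwo.add_self_eq_zero]
  · refine Finset.prod_congr rfl fun i hi => ?_
    rw [flip_apply, if_neg (Finset.ne_of_mem_erase hi)]

theorem walsh_flip_of_notMem {S : Finset (Fin n)} {k : Fin n} (hk : k ∉ S) (x : HammingCube n) :
    walsh S (flip k x) = walsh S x := by
  refine Finset.prod_congr rfl fun i hi => ?_
  rw [flip_apply, if_neg (ne_of_mem_of_not_mem hi hk)]

theorem sum_flip (k : Fin n) (f : HammingCube n → ℝ) : ∑ x, f (flip k x) = ∑ x, f x :=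
  Equiv.sum_comp (Function.Involutive.toPerm (flip k) (flip_flip k)) f

theorem sum_walsh {S : Finset (Fin n)} (hS : S.Nonempty) : ∑ x, walsh S x = 0 := by
  obtain ⟨k, hk⟩ := hS
  have h := sum_flip k (walsh S)
  simp only [walsh_flip_of_mem hk, Finset.sum_neg_distrib] at h
  linarith

/-- The Walsh function `W_S` as an element of the transportation cost space. The constant function
`W_∅` does not have zero sum and is replaced by `0`. -/
noncomputable def walshTC (S : Finset (Fin n)) : TCSpace (HammingCube n) :=
  if hS : S.Nonempty then TCSpace.ofFun (walsh S) (sum_walsh hS) else 0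

theorem toFun_walshTC {S : Finset (Fin n)} (hS : S.Nonempty) :
    TCSpace.toFun _ (walshTC S) = walsh S := by
  rw [walshTC, dif_pos hS, TCSpace.toFun_ofFun]

/-- For `k ∈ S` the Walsh function `W_S` is a signed combination of the edges in direction `k`. -/
theorem two_smul_walshTC {S : Finset (Fin n)} {k : Fin n} (hk : k ∈ S) :
    (2 : ℝ) • walshTC S = ∑ y, walsh S y • TCSpace.dipole y (flip k y) := by
  apply TCSpace.toFun_injective
  funext z
  rw [map_smul, toFun_walshTC ⟨k, hk⟩, map_sum, Finset.sum_apply]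
  have h : ∀ y, (z = flip k y) = (flip k z = y) := fun y => by
    rw [eq_iff_iff]
    constructor
    · rintro rfl
      exact flip_flip k y
    · rintro rfl
      exact (flip_flip k z).symm
  simp [TCSpace.toFun_dipole, h, mul_sub, walsh_flip_of_mem hk, two_mul]

/-! ### The trace of the Walsh functions of degree one and two -/

/-- The family of all sets of one or two coordinates. -/
def smallSets (n : ℕ) : Finset (Finset (Fin n)) :=
  Finset.powersetCard 1 Finset.univ ∪ Finset.powersetCard 2 Finset.univ

theorem mem_smallSets {S : Finset (Fin n)} : S ∈ smallSets n ↔ S.card = 1 ∨ S.card = 2 := by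
  simp [smallSets, Finset.mem_powersetCard]

theorem nonempty_of_mem_smallSets {S : Finset (Fin n)} (hS : S ∈ smallSets n) : S.Nonempty := by
  rw [mem_smallSets] at hS
  exact Finset.card_pos.1 (by omega)

theorem card_smallSets : ((smallSets n).card : ℝ) = n * (n + 1) / 2 := by
  rw [smallSets, Finset.card_union_of_disjoint (Finset.pairwise_disjoint_powersetCard _ (by simp)),
    Finset.card_powersetCard, Finset.card_powersetCard, Finset.card_univ, Fintype.card_fin]
  push_cast [Nat.cast_choose_two, Nat.choose_one_right]
  ring

/-- The sets of at most two coordinates that contain `l` are the sets `{l, k}`, where `k = l` gives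
the singleton. -/
theorem sum_smallSets_mem (l : Fin n) (F : Finset (Fin n) → ℝ) :
    ∑ S ∈ smallSets n with l ∈ S, F S = ∑ k, F {l, k} := by
  symm
  refine Finset.sum_bij (fun k _ => {l, k}) ?_ ?_ ?_ fun _ _ => rfl
  · intro k _
    rw [Finset.mem_filter, mem_smallSets]
    refine ⟨?_, by simp⟩
    by_cases h : l = k
    · simp [h]
    · exact Or.inr (Finset.card_pair h)
  · intro k _ k' _ h
    by_contra hne
    have h1 : k ∈ ({l, k'} : Finset (Fin n)) := h ▸ by simp
    have h2 : k' ∈ ({l, k} : Finset (Fin n)) := h ▸ by simp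
    simp only [Finset.mem_insert, Finset.mem_singleton] at h1 h2
    grind
  · intro S hS
    rw [Finset.mem_filter, mem_smallSets] at hS
    obtain ⟨h | h, hl⟩ := hS
    · obtain ⟨a, rfl⟩ := Finset.card_eq_one.1 h
      exact ⟨a, Finset.mem_univ _, by rw [Finset.mem_singleton.1 hl]; simp⟩
    · obtain ⟨a, b, -, rfl⟩ := Finset.card_eq_two.1 h
      rw [Finset.mem_insert, Finset.mem_singleton] at hl
      rcases hl with rfl | rfl
      · exact ⟨b, Finset.mem_univ _, rfl⟩
      · exact ⟨a, Finset.mem_univ _, Finset.pair_comm _ _⟩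

/-- The function `∑_S φ(W_S) W_S` on the cube, the sum being over all sets of one or two
coordinates. -/
noncomputable def walshSum (φ : TCSpace (HammingCube n) →ₗ[ℝ] ℝ) (x : HammingCube n) : ℝ :=
  ∑ S ∈ smallSets n, walsh S x * φ (walshTC S)

theorem pairing_walshSum (φ : TCSpace (HammingCube n) →ₗ[ℝ] ℝ) (f : TCSpace (HammingCube n)) :
    TCSpace.pairing (walshSum φ) f =
      ∑ S ∈ smallSets n, φ (walshTC S) * TCSpace.pairing (walsh S) f := by
  simp only [TCSpace.pairing_apply, walshSum, Finset.sum_mul, Finset.mul_sum]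
  rw [Finset.sum_comm]
  refine Finset.sum_congr rfl fun S _ => Finset.sum_congr rfl fun v _ => ?_
  ring

/-- The increment of `walshSum φ` along any one edge is at most the sum of `|φ|` over all
oriented edges. -/
theorem abs_walshSum_sub_flip_le (φ : TCSpace (HammingCube n) →ₗ[ℝ] ℝ) (l : Fin n)
    (x : HammingCube n) :
    |walshSum φ x - walshSum φ (flip l x)| ≤ ∑ k, ∑ y, |φ (TCSpace.dipole y (flip k y))| := by
  have h1 : walshSum φ x - walshSum φ (flip l x) =
      ∑ S ∈ smallSets n with l ∈ S, walsh S x * φ ((2 : ℝ) • walshTC S) := by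
    rw [walshSum, walshSum, ← Finset.sum_sub_distrib, Finset.sum_filter]
    refine Finset.sum_congr rfl fun S _ => ?_
    split_ifs with hl
    · rw [walsh_flip_of_mem hl, map_smul, smul_eq_mul]
      ring
    · rw [walsh_flip_of_notMem hl, sub_self]
  rw [h1, sum_smallSets_mem l fun S => walsh S x * φ ((2 : ℝ) • walshTC S)]
  refine (Finset.abs_sum_le_sum_abs _ _).trans (Finset.sum_le_sum fun k _ => ?_)
  -- Expanding `2 W_{l,k}` along the direction `k` makes the edges used for different `k` disjoint.
  rw [two_smul_walshTC (show k ∈ ({l, k} : Finset (Fin n)) by simp), map_sum, abs_mul, abs_walsh,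
    one_mul]
  refine (Finset.abs_sum_le_sum_abs _ _).trans (Finset.sum_le_sum fun y _ => ?_)
  rw [map_smul, smul_eq_mul, abs_mul, abs_walsh, one_mul]

theorem abs_pairing_walshSum_le (φ : TCSpace (HammingCube n) →ₗ[ℝ] ℝ)
    (f : TCSpace (HammingCube n)) :
    |TCSpace.pairing (walshSum φ) f| ≤
      (∑ k, ∑ y, |φ (TCSpace.dipole y (flip k y))|) * ‖f‖ :=
  TCSpace.abs_pairing_le
    (Finset.sum_nonneg fun _ _ => Finset.sum_nonneg fun _ _ => abs_nonneg _)
    (abs_sub_le_mul_dist (abs_walshSum_sub_flip_le φ)) f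

/-- The `j`-th coordinate of a linear map into `ℓ₁ᴺ`. -/
def coord {E : Type*} [AddCommGroup E] [Module ℝ E] {N : ℕ} (T : E →ₗ[ℝ] EllOne N) (j : Fin N) :
    E →ₗ[ℝ] ℝ :=
  LinearMap.proj j ∘ₗ (WithLp.linearEquiv 1 ℝ (Fin N → ℝ)).toLinearMap ∘ₗ T

@[simp]
theorem coord_apply {E : Type*} [AddCommGroup E] [Module ℝ E] {N : ℕ} (T : E →ₗ[ℝ] EllOne N)
    (j : Fin N) (x : E) : coord T j x = T x j := rfl

/-- The trace of `f ↦ ∑_S ⟨f, W_S⟩ W_S`, computed in the basis `T⁻¹ e_j`, equals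
`∑_S ⟨W_S, W_S⟩`. -/
theorem sum_pairing_symm_single {N : ℕ} (T : TCSpace (HammingCube n) ≃ₗ[ℝ] EllOne N) :
    ∑ j, TCSpace.pairing (walshSum (coord T.toLinearMap j)) (T.symm (PiLp.single 1 j 1)) =
      n * (n + 1) / 2 * 2 ^ n := by
  have h : ∀ f : TCSpace (HammingCube n), ∑ j, T f j • T.symm (PiLp.single 1 j 1) = f := by
    intro f
    rw [← T.symm_apply_apply f]
    simp only [← map_smul, ← map_sum, T.apply_symm_apply]
    congr 1
    ext k
    simp [Pi.single_apply]
  calc _ = ∑ S ∈ smallSets n, TCSpace.pairing (walsh S)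
        (∑ j, T (walshTC S) j • T.symm (PiLp.single 1 j 1)) := by
        simp only [pairing_walshSum, coord_apply, LinearEquiv.coe_coe, map_sum, map_smul,
          smul_eq_mul]
        exact Finset.sum_comm
    _ = ∑ S ∈ smallSets n, (2 : ℝ) ^ n := by
        refine Finset.sum_congr rfl fun S hS => ?_
        rw [h, TCSpace.pairing_apply, toFun_walshTC (nonempty_of_mem_smallSets hS)]
        simp only [walsh_mul_self]
        rw [Finset.sum_const, Finset.card_univ, card_eq]
        simp
    _ = _ := by rw [Finset.sum_const, nsmul_eq_mul, card_smallSets]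

theorem le_norm_mul_norm_symm (hn : 1 ≤ n) {N : ℕ} (T : TCSpace (HammingCube n) ≃L[ℝ] EllOne N) :
    ((n : ℝ) + 1) / 2 ≤ ‖(T : TCSpace (HammingCube n) →L[ℝ] EllOne N)‖ *
      ‖(T.symm : EllOne N →L[ℝ] TCSpace (HammingCube n))‖ := by
  set A := ‖(T : TCSpace (HammingCube n) →L[ℝ] EllOne N)‖
  set B := ‖(T.symm : EllOne N →L[ℝ] TCSpace (HammingCube n))‖
  have hB : ∀ j, ‖T.symm (PiLp.single 1 j 1)‖ ≤ B := fun j => by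
    refine ((T.symm : EllOne N →L[ℝ] TCSpace (HammingCube n)).le_opNorm _).trans ?_
    rw [PiLp.norm_single, norm_one, mul_one]
  have hA : ∀ k (y : HammingCube n), ∑ j, |T (TCSpace.dipole y (flip k y)) j| ≤ A := fun k y => by
    have h1 := (T : TCSpace (HammingCube n) →L[ℝ] EllOne N).le_opNorm
      (TCSpace.dipole y (flip k y))
    rw [PiLp.norm_eq_of_L1] at h1
    exact h1.trans (mul_le_of_le_one_right (norm_nonneg _)
      ((TCSpace.norm_dipole_le _ _).trans (dist_flip_le k y)))
  have h : (n : ℝ) * (n + 1) / 2 * 2 ^ n ≤ (n * 2 ^ n) * (A * B) := calc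
    _ = ∑ j, TCSpace.pairing (walshSum (coord T.toLinearEquiv.toLinearMap j))
          (T.symm (PiLp.single 1 j 1)) := (sum_pairing_symm_single T.toLinearEquiv).symm
    _ ≤ ∑ j, (∑ k, ∑ y, |T (TCSpace.dipole y (flip k y)) j|) * B := by
        refine Finset.sum_le_sum fun j _ => (le_abs_self _).trans
          ((abs_pairing_walshSum_le _ _).trans ?_)
        exact mul_le_mul_of_nonneg_left (hB j)
          (Finset.sum_nonneg fun _ _ => Finset.sum_nonneg fun _ _ => abs_nonneg _)
    _ = (∑ k, ∑ y, ∑ j, |T (TCSpace.dipole y (flip k y)) j|) * B := by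
        rw [← Finset.sum_mul, Finset.sum_comm]
        refine congrArg (· * B) (Finset.sum_congr rfl fun k _ => Finset.sum_comm)
    _ ≤ (∑ _k : Fin n, ∑ _y : HammingCube n, A) * B :=
        mul_le_mul_of_nonneg_right (Finset.sum_le_sum fun k _ => Finset.sum_le_sum fun y _ =>
          hA k y) (norm_nonneg _)
    _ = _ := by
        simp only [Finset.sum_const, Finset.card_univ, card_eq, Fintype.card_fin, nsmul_eq_mul]
        push_cast
        ring
  have hpos : (0 : ℝ) < n * 2 ^ n := by
    have : (0 : ℝ) < n := by exact_mod_cast hn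
    positivity
  refine le_of_mul_le_mul_left (le_trans (le_of_eq ?_) h) hpos
  ring

end HammingCube

theorem corollaryC (n : ℕ) (hn : 1 ≤ n) :
    ((n : ℝ) + 1) / 2 ≤ banachMazurDist (TCSpace (HammingCube n)) (EllOne (2 ^ n - 1)) ∧
      banachMazurDist (TCSpace (HammingCube n)) (EllOne (2 ^ n - 1)) ≤ 2 * (n : ℝ) := by
  have hstar := TCSpace.exists_equiv_ellOne (X := HammingCube n) (D := n)
    (fun _ _ => HammingCube.one_le_dist) HammingCube.dist_le
  rw [HammingCube.card_eq] at hstar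
  obtain ⟨T, hT⟩ := hstar
  refine ⟨le_csInf ⟨_, T, rfl⟩ ?_, (banachMazurDist_le T).trans hT⟩
  rintro _ ⟨S, rfl⟩
  exact HammingCube.le_norm_mul_norm_symm hn S
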